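/- Consider the deterministic congested clique: $n$ processors with distinct identifiers of $O(\log n)$ bits communicate in synchronous rounds; in each round every processor may send a (possibly different) message of $O(\log n)$ bits to each other processor; local computation is free, and $n$ and the parameter $\Delta$ below are known to all processors. Let $G=(V,E)$ be a directed graph whose $n$ vertices are the processors, with $s,t\in V$. An $s$-$t$ flow is a function $f\colon E\to\mathbb{R}_{\ge 0}$ that respects given integral edge capacities and satisfies $\sum_{(v,u)\in E}f(v,u)=\sum_{(u,v)\in E}f(u,v)$ for all $v\in V\setminus\{s,t\}$; its value is $\sum_{(s,u)\in E}f(s,u)-\sum_{(u,s)\in E}f(u,s)$. Let $f$ be an $s$-$t$ flow and let $\Delta$ be a real number such that $1/\Delta=2^k$ for some integer $k\ge 0$ and $f(e)$ is an integer multiple of $\Delta$ for every $e\in E$. Initially each vertex knows its own identifier, whether it is $s$ or $t$, and, for each edge $e$ incident to it, the direction of $e$, the identifier of the other endpoint and $f(e)$ (and the cost of $e$, if there are costs). At the end both endpoints of each edge $e$ must know the new value $f'(e)$. 1. There is a deterministic congested clique algorithm that computes an $s$-$t$ flow $f'$, within the same capacities, with $f'(e)\in\{\lfloor f(e)\rfloor,\lceil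 f(e)\rceil\}$ for all $e\in E$, whose value is not less than that of $f$. 2. If moreover the value of $f$ is an integer and there are costs $c\colon E\to\mathbb{Z}_{\ge 0}$ that are bounded by a polynomial in $n$, there is a deterministic congested clique algorithm that computes an $s$-$t$ flow $f'$, within the same capacities, with $f'(e)\in\{\lfloor f(e)\rfloor,\lceil f(e)\rceil\}$ for all $e\in E$, whose value is not less than that of $f$ and such that $\sum_{e\in E}c(e)f'(e)\le\sum_{e\in E}c(e)f(e)$. Both algorithms use $O(\log n\cdot\log^* n\cdot\log(1/\Delta))$ rounds. The constant in this bound and the one in the message size depend only on the exponent $a$ for which the identifiers and costs are at most $n^a$. -/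

import Mathlib

/-! ### The congested clique -/

/-- A message of at most `b` bits (the empty message means silence). -/
abbrev Message (b : ℕ) : Type := {l : List Bool // l.length ≤ b}

/-- A clique of `n` processors. Processors do not see their index in `Fin n`: they have pairwise
distinct identifiers, and processor `v` reaches the others through `n - 1` ports, which are
numbered arbitrarily (`port v p` is the processor at the other end of port `p` of `v`). -/
structure CliqueNetwork (n : ℕ) where
  id : Fin n → ℕ
  id_injective : Function.Injective id
  port : (v : Fin n) → Fin (n - 1) ≃ {u : Fin n // u ≠ v}

/-- A deterministic algorithm for `n` processors with messages of at most `b` bits, local inputs in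
`I` and local outputs in `O`. All processors run the same program; local computation is free. In
each round a processor may send a different message through each of its ports. -/
structure CliqueAlgorithm (n b : ℕ) (I O : Type) where
  State : Type
  init : I → State
  send : State → Fin (n - 1) → Message b
  receive : State → (Fin (n - 1) → Message b) → State
  rounds : ℕ
  output : State → O

namespace CliqueAlgorithm

variable {n b : ℕ} {I O : Type}

/-- One synchronous round: on port `p`, processor `v` receives what the processor `port v p`
sends through its own port that leads to `v`. -/
def step (A : CliqueAlgorithm n b I O) (N : CliqueNetwork n) (σ : Fin n → A.State) :
    Fin n → A.State :=
  fun v => A.receive (σ v) fun p =>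
    A.send (σ (N.port v p)) ((N.port (N.port v p)).symm ⟨v, (N.port v p).2.symm⟩)

/-- The local outputs after the last round, on local inputs `x`. -/
def run (A : CliqueAlgorithm n b I O) (N : CliqueNetwork n) (x : Fin n → I) : Fin n → O :=
  fun v => A.output ((A.step N)^[A.rounds] (fun u => A.init (x u)) v)

end CliqueAlgorithm

/-- What a node of an edge-labelled directed graph with source and sink knows initially: its own
identifier, whether it is the source or the sink, and its outgoing and incoming edges, each given as
the identifier of the other endpoint together with the label of the edge. -/
structure LocalInput (L : Type) where
  id : ℕ
  isSource : Bool
  isSink : Bool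
  outEdges : Set (ℕ × L)
  inEdges : Set (ℕ × L)

/-- The local inputs for the graph with edge set `E` and labels `label`. -/
def localInput {n : ℕ} {L : Type} (N : CliqueNetwork n) (E : Finset (Fin n × Fin n))
    (s t : Fin n) (label : Fin n × Fin n → L) (v : Fin n) : LocalInput L where
  id := N.id v
  isSource := decide (v = s)
  isSink := decide (v = t)
  outEdges := {x | ∃ u, (v, u) ∈ E ∧ x = (N.id u, label (v, u))}
  inEdges := {x | ∃ u, (u, v) ∈ E ∧ x = (N.id u, label (u, v))}

/-- The output of a node: a value for each outgoing and each incoming edge, addressed by the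
identifier of the other endpoint. -/
structure LocalOutput where
  outFlow : ℕ → ℝ
  inFlow : ℕ → ℝ

/-- The local outputs `y` give the function `g` on the edges: both endpoints of every edge `e`
output `g e`. -/
def Outputs {n : ℕ} (N : CliqueNetwork n) (E : Finset (Fin n × Fin n))
    (y : Fin n → LocalOutput) (g : Fin n × Fin n → ℝ) : Prop :=
  ∀ e ∈ E, (y e.1).outFlow (N.id e.2) = g e ∧ (y e.2).inFlow (N.id e.1) = g e

/-! ### Flows -/

section Flow

variable {V : Type} [DecidableEq V]

/-- Flow out of `v` minus flow into `v`. -/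
def netOutflow (E : Finset (V × V)) (f : V × V → ℝ) (v : V) : ℝ :=
  (∑ e ∈ E with e.1 = v, f e) - ∑ e ∈ E with e.2 = v, f e

/-- `f` is an `s`-`t` flow in the directed graph with edge set `E` and integral capacities `cap`. -/
structure IsFlow (E : Finset (V × V)) (cap : V × V → ℕ) (s t : V) (f : V × V → ℝ) : Prop where
  nonneg : ∀ e ∈ E, 0 ≤ f e
  conservation : ∀ v, v ≠ s → v ≠ t → netOutflow E f v = 0
  le_capacity : ∀ e ∈ E, f e ≤ cap e

/-- The value of an `s`-`t` flow. -/
def flowValue (E : Finset (V × V)) (s : V) (f : V × V → ℝ) : ℝ := netOutflow E f s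

/-- The cost of a flow. -/
def flowCost (E : Finset (V × V)) (c : V × V → ℕ) (f : V × V → ℝ) : ℝ := ∑ e ∈ E, (c e : ℝ) * f e

/-- On every edge, `g` is `f` rounded down or up. -/
def IsRounding (E : Finset (V × V)) (f g : V × V → ℝ) : Prop :=
  ∀ e ∈ E, g e = (⌊f e⌋ : ℝ) ∨ g e = (⌈f e⌉ : ℝ)

/-- `1 / Δ` is a power of two and `f` is an integer multiple of `Δ` on every edge. -/
def HasGranularity (E : Finset (V × V)) (f : V × V → ℝ) (Δ : ℝ) : Prop :=
  (∃ k : ℕ, 1 / Δ = 2 ^ k) ∧ ∀ e ∈ E, ∃ z : ℤ, f e = z * Δ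

end Flow

/-! ### The iterated logarithm -/

/-- `log* n`, the least number of binary logarithms that bring `n` down to at most `1`. Rounding
each logarithm up does not change this number, since `⌈log₂ m⌉ ≤ j` means `m ≤ 2 ^ j`. -/
noncomputable def logStar (n : ℕ) : ℕ := sInf {k : ℕ | (Nat.clog 2)^[k] n ≤ 1}

/-! In units of `Δ = 1 / 2 ^ k` the flow is an integer matrix, whose binary digits are cleared from
the lowest up. In phase `j` all entries are multiples of `2 ^ j`, and each entry that is not a
multiple of `2 ^ (j + 1)`, an odd edge, changes by `± 2 ^ j`. Suppose that the signs, read as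
directions of the odd edges, give every vertex net outflow at most 1 in absolute value. By parity it
is 0 wherever the net sum is divisible by `2 ^ (j + 1)`, so conservation survives. Reversing all
directions preserves this, so one global sign keeps the cost from growing (`exists_doubled`). After
`k` phases each entry has moved by less than `2 ^ k`, hence to the floor or the ceiling.

The directions come from decomposing the odd edges into trails and directing each trail. Only the
pairing of trail ends matters, an involution of the vertices. Each processor starts with the star of
its own odd out-edges. Two families merge given their involutions alone, and directions of the
merged trails pull back to both families (`exists_merge`). Merging along a binary tree costs four
rounds per level (`exists_signings`), so a phase takes `4 * ⌈log₂ n⌉ + 1` rounds; the factor `log*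
n` is slack.

With costs, an integral value is preserved exactly. Without costs, minus the value serves as the
cost. -/

/-! ### Signings -/

section Signing

variable {V : Type}

/-- An involution `p` records the pairs of ends of a family of trails. The sign vector `σ` is the
net outflow of a choice of directions of these trails. -/
def Signing (p : V → V) (σ : V → ℤ) : Prop :=
  (∀ k, σ (p k) = -σ k) ∧ ∀ k, p k ≠ k → σ k = 1 ∨ σ k = -1

theorem Signing.eq_zero {p : V → V} {σ : V → ℤ} (h : Signing p σ) {k : V} (hk : p k = k) :
    σ k = 0 := by
  have := h.1 k
  rw [hk] at this
  omega

theorem Signing.mem {p : V → V} {σ : V → ℤ} (h : Signing p σ) (k : V) :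
    σ k ∈ Finset.Icc (-1 : ℤ) 1 := by
  by_cases hk : p k = k
  · simp [h.eq_zero hk]
  · rcases h.2 k hk with h | h <;> simp [h]

/-- The net outflow at `k` of one unit on an edge from `a` to `b`. -/
def unitNet [DecidableEq V] (a b k : V) : ℤ := (if k = a then 1 else 0) - if k = b then 1 else 0

/-- The edge joins the trails ending at `a` and `b`, so their other ends become partners; a fixed
point of `p` counts as an empty trail. If `p a = b`, the trail closes up and either direction works.
-/
theorem exists_insert_edge [DecidableEq V] (p : V → V) (hp : Function.Involutive p) (a b : V) :
    ∃ q : V → V, Function.Involutive q ∧ ∀ τ, Signing q τ → ∃ ε : ℤ, (ε = 1 ∨ ε = -1) ∧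
      Signing p fun k => τ k - ε * unitNet a b k := by
  have hp' : ∀ k, p (p k) = k := hp
  by_cases hab : a = b
  · subst hab
    exact ⟨p, hp, fun τ hτ => ⟨1, Or.inl rfl, by simpa [unitNet] using hτ⟩⟩
  by_cases hpab : p a = b
  · refine ⟨fun k => if k = a ∨ k = b then k else p k, ?_, ?_⟩
    · intro k
      grind
    · rintro τ hτ
      have hτa : τ a = 0 := hτ.eq_zero (by simp)
      have hτb : τ b = 0 := hτ.eq_zero (by simp)
      obtain ⟨h1, h2⟩ := hτ
      refine ⟨1, Or.inl rfl, ?_, ?_⟩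
      · intro k
        have := h1 k
        simp only [unitNet]
        grind
      · intro k hk
        have := h2 k
        simp only [unitNet]
        grind
  · refine ⟨fun k => if k = p a then p b else if k = p b then p a else
      if k = a ∨ k = b then k else p k, ?_, ?_⟩
    · intro k
      grind
    · rintro τ ⟨h1, h2⟩
      have hpp : p a ≠ p b := fun h => hab (hp.injective h)
      -- The unit that leaves `p a` arrives at `a` and continues along the edge to `b`.
      refine ⟨τ (p a), h2 _ (by simp [hpp.symm]), ?_, ?_⟩
      · intro k
        have e1 := h1 k
        have e2 := h1 a
        have e3 := h1 b
        have e4 := h1 (p a)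
        have e5 := h1 (p b)
        simp only [unitNet]
        grind
      · intro k hk
        have e0 := h2 k
        have e1 := h2 (p a)
        have e2 := h1 a
        have e3 := h1 b
        have e4 := h1 (p a)
        simp only [unitNet]
        grind

/-- Edges are directed in the reverse order of insertion: directing the last one leaves a signing
for the family before it. -/
theorem exists_insert_edges [DecidableEq V] {ι : Type} [DecidableEq ι] (p : V → V)
    (hp : Function.Involutive p) (a b : ι → V) (S : Finset ι) :
    ∃ q : V → V, Function.Involutive q ∧ ∀ τ, Signing q τ → ∃ ε : ι → ℤ,
      (∀ i, ε i = 1 ∨ ε i = -1) ∧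
      Signing p fun k => τ k - ∑ i ∈ S, ε i * unitNet (a i) (b i) k := by
  induction S using Finset.induction_on with
  | empty => exact ⟨p, hp, fun τ hτ => ⟨1, fun i => Or.inl rfl, by simpa using hτ⟩⟩
  | insert j S hj ih =>
    obtain ⟨q, hq, h⟩ := ih
    obtain ⟨q', hq', h'⟩ := exists_insert_edge q hq (a j) (b j)
    refine ⟨q', hq', fun τ hτ => ?_⟩
    obtain ⟨δ, hδ, hs⟩ := h' τ hτ
    obtain ⟨ε, hε, hs'⟩ := h _ hs
    refine ⟨Function.update ε j δ, fun i => ?_, ?_⟩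
    · by_cases hi : i = j
      · subst hi
        simpa using hδ
      · simpa [hi] using hε i
    · convert hs' using 2 with k
      rw [Finset.sum_insert hj, Function.update_self, sub_sub]
      congr 2
      refine Finset.sum_congr rfl fun i hi => ?_
      rw [Function.update_of_ne (by rintro rfl; exact hj hi)]

/-- Each trail of `p₂` acts as a single edge between its ends and is inserted into `p₁`. The
directions of these edges form `σ₂`, the remainder is `σ₁`. The clause on `id` keeps empty parts of
the merging tree empty. -/
theorem exists_merge [Fintype V] [LinearOrder V] (p₁ p₂ : V → V) (h₁ : Function.Involutive p₁)
    (h₂ : Function.Involutive p₂) :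
    ∃ q : V → V, Function.Involutive q ∧ (p₁ = id → p₂ = id → q = id) ∧
      ∀ τ, Signing q τ → ∃ σ₁ σ₂ : V → ℤ, Signing p₁ σ₁ ∧ Signing p₂ σ₂ ∧
        ∀ k, σ₁ k + σ₂ k = τ k := by
  by_cases hid : p₁ = id ∧ p₂ = id
  · refine ⟨id, fun _ => rfl, fun _ _ => rfl, fun τ hτ => ⟨τ, 0, ?_, ?_, by simp⟩⟩
    · rw [hid.1]
      exact hτ
    · rw [hid.2]
      exact ⟨by simp, by simp⟩
  -- The condition `k < p₂ k` takes each pair of ends once.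
  obtain ⟨q, hq, h⟩ := exists_insert_edges p₁ h₁ id p₂ (Finset.univ.filter fun k => k < p₂ k)
  refine ⟨q, hq, fun e₁ e₂ => absurd ⟨e₁, e₂⟩ hid, fun τ hτ => ?_⟩
  obtain ⟨ε, hε, hs⟩ := h τ hτ
  refine ⟨_, _, hs, ?_, fun k => sub_add_cancel _ _⟩
  have key : ∀ k, ∑ i ∈ Finset.univ.filter (fun k => k < p₂ k), ε i * unitNet (id i) (p₂ i) k =
      (if k < p₂ k then ε k else 0) - if p₂ k < k then ε (p₂ k) else 0 := by
    intro k
    have e : ∀ i, (k = p₂ i) ↔ (p₂ k = i) := fun i =>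
      ⟨fun h => by rw [h, h₂ i], fun h => by rw [← h, h₂ k]⟩
    simp only [unitNet, mul_sub, Finset.sum_sub_distrib, e, id]
    simp [Finset.sum_ite_eq, h₂ k]
  simp only [key]
  constructor
  · intro k
    simp only [h₂ k]
    ring
  · intro k hk
    rcases lt_or_gt_of_ne hk with h | h
    · have := hε (p₂ k)
      simp only [h, h.not_gt, if_true, if_false]
      omega
    · simpa [h, h.not_gt] using hε k

/-- A signing of the involution of the ends of trails always exists. -/
theorem exists_signing [LinearOrder V] (p : V → V) (hp : Function.Involutive p) :
    ∃ σ, Signing p σ := by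
  refine ⟨fun k => if k < p k then 1 else if p k < k then -1 else 0, fun k => ?_, fun k hk => ?_⟩
  · simp only [hp k]
    rcases lt_trichotomy k (p k) with h | h | h
    · simp [h, h.not_gt]
    · simp [← h]
    · simp [h, h.not_gt]
  · rcases lt_or_gt_of_ne hk with h | h
    · simp [h, h.not_gt]
    · simp [h]

end Signing

/-! ### Knowledge of the processors -/

section Knowledge

variable {n b : ℕ} {I S S' X : Type}

/-- The input of a processor and all messages that it received, the latest first. -/
abbrev History (n b : ℕ) (I : Type) : Type := I × List (Fin (n - 1) → Message b)

/-- What a processor learns when all processors with states `σ` send according to `send`. -/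
def CliqueNetwork.inbox (N : CliqueNetwork n) (send : S → Fin (n - 1) → Message b)
    (σ : Fin n → S) (v : Fin n) (p : Fin (n - 1)) : Message b :=
  send (σ (N.port v p)) ((N.port (N.port v p)).symm ⟨v, (N.port v p).2.symm⟩)

/-- The histories after `r` rounds. -/
def CliqueNetwork.histories (N : CliqueNetwork n)
    (send : History n b I → Fin (n - 1) → Message b) (x : Fin n → I) :
    ℕ → Fin n → History n b I
  | 0 => fun v => (x v, [])
  | r + 1 => fun v =>
    ((N.histories send x r v).1, N.inbox send (N.histories send x r) v ::
      (N.histories send x r v).2)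

theorem CliqueNetwork.length_histories (N : CliqueNetwork n)
    (send : History n b I → Fin (n - 1) → Message b) (x : Fin n → I) (r : ℕ) (v : Fin n) :
    (N.histories send x r v).2.length = r := by
  induction r with
  | zero => rfl
  | succ r ih => simp [histories, ih]

theorem CliqueNetwork.histories_congr (N : CliqueNetwork n)
    {send send' : History n b I → Fin (n - 1) → Message b} (x : Fin n → I) (r : ℕ)
    (h : ∀ H : History n b I, H.2.length < r → send H = send' H) :
    N.histories send x r = N.histories send' x r := by
  induction r with
  | zero => rfl
  | succ r ih =>
    have e := ih fun H hH => h H (by omega)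
    funext v
    simp only [histories, e, Prod.mk.injEq, List.cons.injEq, true_and, and_true]
    funext p
    simp only [inbox]
    rw [h _ (by rw [length_histories]; omega)]

/-- On the instances `x : X` with networks `N x` and local inputs `inp x`, some algorithm with `r`
rounds lets every processor `v` know `K x v`. -/
def Knows (b : ℕ) (N : X → CliqueNetwork n) (inp : X → Fin n → I) (r : ℕ) (K : X → Fin n → S) :
    Prop :=
  ∃ (send : History n b I → Fin (n - 1) → Message b) (F : History n b I → S),
    ∀ x v, K x v = F ((N x).histories send (inp x) r v)

variable {N : X → CliqueNetwork n} {inp : X → Fin n → I} {r : ℕ} {K : X → Fin n → S}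

theorem knows_input : Knows b N inp 0 inp :=
  ⟨fun _ _ => ⟨[], Nat.zero_le b⟩, Prod.fst, fun _ _ => rfl⟩

theorem Knows.map (h : Knows b N inp r K) (F : S → S') :
    Knows b N inp r fun x v => F (K x v) := by
  obtain ⟨send, G, h⟩ := h
  exact ⟨send, F ∘ G, fun x v => congrArg F (h x v)⟩

theorem Knows.round (h : Knows b N inp r K) (send : S → Fin (n - 1) → Message b) :
    Knows b N inp (r + 1) fun x v => (K x v, (N x).inbox send (K x) v) := by
  classical
  obtain ⟨send₀, F, h⟩ := h
  -- The length of the history tells the current round.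
  let send₁ : History n b I → Fin (n - 1) → Message b :=
    fun H => if H.2.length = r then send (F H) else send₀ H
  refine ⟨send₁, fun H => (F (H.1, H.2.tail), H.2.headD fun _ => ⟨[], Nat.zero_le b⟩),
    fun x v => ?_⟩
  have e : (N x).histories send₁ (inp x) r = (N x).histories send₀ (inp x) r :=
    (N x).histories_congr _ _ fun H hH => by simp [send₁, hH.ne]
  simp only [CliqueNetwork.histories, e, List.tail_cons, List.headD_cons, Prod.mk.injEq]
  refine ⟨h x v, ?_⟩
  funext p
  simp only [CliqueNetwork.inbox, send₁, CliqueNetwork.length_histories, if_true, h]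

theorem Knows.exists_algorithm (h : Knows b N inp r K) :
    ∃ A : CliqueAlgorithm n b I S, A.rounds = r ∧ ∀ x, A.run (N x) (inp x) = K x := by
  obtain ⟨send, F, h⟩ := h
  let A : CliqueAlgorithm n b I S :=
    { State := History n b I
      init := fun i => (i, [])
      send := send
      receive := fun H m => (H.1, m :: H.2)
      rounds := r
      output := F }
  refine ⟨A, rfl, fun x => ?_⟩
  have key : ∀ t, (A.step (N x))^[t] (fun u => A.init (inp x u)) =
      (N x).histories send (inp x) t := by
    intro t
    induction t with
    | zero => rfl
    | succ t ih =>
      rw [Function.iterate_succ_apply', ih]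
      rfl
  funext v
  rw [h x v]
  exact congrArg (fun H => F (H v)) (key r)

theorem exists_encoding {M : Type} (D : Finset M) (hD : D.card ≤ 2 ^ b) :
    ∃ enc : M → Message b, Set.InjOn enc D := by
  classical
  have : Fintype.card D ≤ Fintype.card (Fin b → Bool) := by simpa using hD
  obtain ⟨φ⟩ := Function.Embedding.nonempty_of_card_le this
  refine ⟨fun m => if h : m ∈ D then ⟨List.ofFn (φ ⟨m, h⟩), by simp⟩ else ⟨[], Nat.zero_le b⟩,
    fun m hm m' hm' h => ?_⟩
  rw [Finset.mem_coe] at hm hm'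
  simp only [hm, hm', dif_pos, Subtype.mk.injEq] at h
  exact congrArg Subtype.val (φ.injective (List.ofFn_injective h))

/-- The processors know `K` in terms of a common numbering `π x` of the processors, and they know
which numbers they and the processors at their ports have. -/
def RankKnows (b : ℕ) (N : X → CliqueNetwork n) (inp : X → Fin n → I) (π : X → Fin n ≃ Fin n)
    (r : ℕ) (K : X → Fin n → S) : Prop :=
  Knows b N inp r fun x v => ((π x v, fun p => π x ((N x).port v p)), K x (π x v))

variable {π : X → Fin n ≃ Fin n}

theorem RankKnows.map (h : RankKnows b N inp π r K) (F : Fin n → S → S') :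
    RankKnows b N inp π r fun x k => F k (K x k) :=
  Knows.map h fun s => (s.1, F s.1.1 s.2)

/-- One round of messages, addressed by the numbers of the processors. -/
theorem RankKnows.exchange {M : Type} [Nonempty M] (h : RankKnows b N inp π r K) (D : Finset M)
    (hD : D.card ≤ 2 ^ b) (msg : Fin n → S → Fin n → M) (hmsg : ∀ x k l, msg k (K x k) l ∈ D) :
    RankKnows b N inp π (r + 1) fun x k => (K x k, fun l => msg l (K x l) k) := by
  classical
  obtain ⟨enc, henc⟩ := exists_encoding D hD
  have hround := Knows.round h fun s p => enc (msg s.1.1 s.2 (s.1.2 p))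
  -- No port leads to the processor itself; its message to itself is computed locally.
  have hmap := hround.map fun s => (s.1.1, (s.1.2, fun l =>
    if hl : ∃ p, s.1.1.2 p = l then Function.invFunOn enc D (s.2 hl.choose)
    else msg s.1.1.1 s.1.2 l))
  refine (congrArg (Knows b N inp (r + 1)) ?_).mpr hmap
  funext x v
  refine Prod.ext rfl (Prod.ext rfl (funext fun l => ?_))
  dsimp only
  split_ifs with hl
  · obtain ⟨p, hp⟩ : ∃ p, p = hl.choose := ⟨_, rfl⟩
    have hl' : π x ((N x).port v p) = l := hp ▸ hl.choose_spec
    rw [← hp]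
    simp only [CliqueNetwork.inbox, Equiv.apply_symm_apply]
    rw [henc.leftInvOn_invFunOn (hmsg _ _ _), hl']
  · have : l = π x v := by
      by_contra hne
      refine hl ⟨((N x).port v).symm ⟨(π x).symm l, fun e => hne ?_⟩, ?_⟩
      · rw [← e, Equiv.apply_symm_apply]
      · simp
    rw [this]

/-- A common numbering of the processors is known after one round, in which the processors exchange
their identifiers, here together with one more bit. -/
theorem exists_rankKnows [NeZero n] (idOf : I → ℕ) (bit : I → Bool) (m : ℕ) (hm : m * 2 ≤ 2 ^ b)
    (hid : ∀ x v, idOf (inp x v) = (N x).id v) (hlt : ∀ x v, (N x).id v < m) :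
    ∃ π : X → Fin n ≃ Fin n, RankKnows b N inp π 1 fun x k =>
      (inp x ((π x).symm k), (fun l => (N x).id ((π x).symm l)),
        fun l => bit (inp x ((π x).symm l))) := by
  classical
  obtain ⟨enc, henc⟩ := exists_encoding (b := b) (Finset.range m ×ˢ (Finset.univ : Finset Bool))
    (by simpa using hm)
  let ids : X → Finset ℕ := fun x => Finset.univ.image (N x).id
  -- The numbering depends only on the set of identifiers, which everybody knows after the round, so
  -- all processors agree on it.
  let rank : Finset ℕ → ℕ → Fin n := fun T i =>
    if h : T.card = n ∧ i ∈ T then T.equivFinOfCardEq h.1 ⟨i, h.2⟩ else 0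
  have hcard : ∀ x, (ids x).card = n := fun x => by
    simp [ids, Finset.card_image_of_injective _ (N x).id_injective]
  have hmem : ∀ x v, (N x).id v ∈ ids x := fun x v => by simp [ids]
  have hinj : ∀ x, Function.Injective fun v => rank (ids x) ((N x).id v) := by
    intro x v w h
    simp only [rank, hcard, hmem, and_self, dif_pos] at h
    exact (N x).id_injective (congrArg Subtype.val (Equiv.injective _ h))
  let π : X → Fin n ≃ Fin n := fun x =>
    Equiv.ofBijective _ (Finite.injective_iff_bijective.1 (hinj x))
  have hπ : ∀ x v, π x v = rank (ids x) ((N x).id v) := fun x v => rfl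
  refine ⟨π, ?_⟩
  have hround := (knows_input (b := b) (N := N) (inp := inp)).round
    fun i _ => enc (idOf i, bit i)
  -- the received pairs of an identifier and a bit, together with the pair of the processor itself
  let got : I × (Fin (n - 1) → Message b) → Fin (n - 1) → ℕ × Bool := fun s p =>
    Function.invFunOn enc (Finset.range m ×ˢ (Finset.univ : Finset Bool) : Finset _) (s.2 p)
  let all : I × (Fin (n - 1) → Message b) → Finset (ℕ × Bool) := fun s =>
    insert (idOf s.1, bit s.1) (Finset.univ.image (got s))
  have hgot : ∀ x v p, got (inp x v, (N x).inbox (fun i _ => enc (idOf i, bit i)) (inp x) v) p =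
      ((N x).id ((N x).port v p), bit (inp x ((N x).port v p))) := by
    intro x v p
    simp only [got, CliqueNetwork.inbox]
    rw [henc.leftInvOn_invFunOn (by simp [hid, hlt]), hid]
  have hall : ∀ x v, all (inp x v, (N x).inbox (fun i _ => enc (idOf i, bit i)) (inp x) v) =
      Finset.univ.image fun u => ((N x).id u, bit (inp x u)) := by
    intro x v
    ext ⟨i, β⟩
    simp only [all, Finset.mem_insert, Finset.mem_image, Finset.mem_univ, true_and, hgot, hid,
      Prod.mk.injEq]
    constructor
    · rintro (⟨rfl, rfl⟩ | ⟨p, rfl, rfl⟩)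
      · exact ⟨v, rfl, rfl⟩
      · exact ⟨_, rfl, rfl⟩
    · rintro ⟨u, rfl, rfl⟩
      by_cases hu : u = v
      · exact Or.inl ⟨hu ▸ rfl, hu ▸ rfl⟩
      · exact Or.inr ⟨((N x).port v).symm ⟨u, hu⟩, by simp, by simp⟩
  have hids : ∀ x, (Finset.univ.image fun u => ((N x).id u, bit (inp x u))).image Prod.fst =
      ids x := fun x => by
    rw [Finset.image_image]
    rfl
  have hpair : ∀ x l, ∃ j, j ∈ (Finset.univ.image fun u => ((N x).id u, bit (inp x u))) ∧
      rank (ids x) j.1 = l := fun x l =>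
    ⟨((N x).id ((π x).symm l), bit (inp x ((π x).symm l))),
      Finset.mem_image.2 ⟨_, Finset.mem_univ _, rfl⟩, by
      rw [← hπ, Equiv.apply_symm_apply]⟩
  let find : Finset (ℕ × Bool) → Fin n → ℕ × Bool := fun T l =>
    if h : ∃ j, j ∈ T ∧ rank (T.image Prod.fst) j.1 = l then h.choose else (0, false)
  have hfind : ∀ x l, find (Finset.univ.image fun u => ((N x).id u, bit (inp x u))) l =
      ((N x).id ((π x).symm l), bit (inp x ((π x).symm l))) := by
    intro x l
    simp only [find, hids]
    rw [dif_pos (hpair x l)]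
    obtain ⟨h1, h2⟩ := (hpair x l).choose_spec
    generalize (hpair x l).choose = j at h1 h2
    obtain ⟨u, -, rfl⟩ := Finset.mem_image.1 h1
    have : π x u = l := h2
    simp [← this]
  have hmap := hround.map fun s =>
    ((rank ((all s).image Prod.fst) (idOf s.1),
      fun p => rank ((all s).image Prod.fst) (got s p).1),
      (s.1, (fun l => (find (all s) l).1), fun l => (find (all s) l).2))
  simp only [hall, hids, hgot, hfind, hid] at hmap
  simp only [RankKnows, Equiv.symm_apply_apply]
  simpa only [hπ] using hmap

end Knowledge

/-! ### Signing the edges of all processors -/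

section Algorithm

variable {n b r : ℕ} {I X : Type} {N : X → CliqueNetwork n} {inp : X → Fin n → I}
  {π : X → Fin n ≃ Fin n}

/-- The value at `m` of a function on `Fin n` that is extended by `d`. -/
def extendFin {α : Type} (F : Fin n → α) (d : α) (m : ℕ) : α := if h : m < n then F ⟨m, h⟩ else d

theorem sum_range_two_mul {M : Type} [AddCommMonoid M] (G : ℕ → M) (m : ℕ) :
    ∑ i ∈ Finset.range (2 * m), G i = ∑ j ∈ Finset.range m, (G (2 * j) + G (2 * j + 1)) := by
  induction m with
  | zero => simp
  | succ m ih =>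
    rw [show 2 * (m + 1) = 2 * m + 1 + 1 by ring, Finset.sum_range_succ, Finset.sum_range_succ,
      Finset.sum_range_succ, ih, add_assoc]

/-- In the merging tree, processor `j` has the children `2 * j` and `2 * j + 1`; missing children
contribute 0. -/
theorem sum_fin_eq_sum_children {M : Type} [AddCommMonoid M] (G : Fin n → M) :
    ∑ i, G i = ∑ j : Fin n, (extendFin G 0 (2 * j) + extendFin G 0 (2 * j + 1)) := by
  have e : ∑ i, G i = ∑ i ∈ Finset.range n, extendFin G 0 i := by
    rw [Finset.sum_range]
    exact Finset.sum_congr rfl fun i _ => by simp [extendFin]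
  rw [e, ← Finset.sum_range fun j => extendFin G 0 (2 * j) + extendFin G 0 (2 * j + 1),
    ← sum_range_two_mul]
  refine Finset.sum_subset (Finset.range_subset_range.2 (by omega)) fun m _ hm => ?_
  simp only [Finset.mem_range] at hm
  simp [extendFin, hm]

/-- If processor `i` knows the involution `P x i`, then signings of all these involutions that
almost cancel each other can be found by merging the involutions in pairs. -/
theorem exists_signings [NeZero n] (hb : n * n ≤ 2 ^ b) (hb' : 9 ≤ 2 ^ b) (L : ℕ) :
    ∀ {S : Type} {r : ℕ} {K : X → Fin n → S} {P : X → Fin n → Fin n → Fin n},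
      RankKnows b N inp π r (fun x k => (K x k, P x k)) →
      (∀ x i, Function.Involutive (P x i)) →
      (∀ x (i : Fin n), 2 ^ L ≤ i.val → P x i = id) →
      ∃ σ : X → Fin n → Fin n → ℤ, RankKnows b N inp π (r + 4 * L) (fun x k => (K x k, σ x k)) ∧
        (∀ x i, Signing (P x i) (σ x i)) ∧ ∀ x k, |∑ i, σ x i k| ≤ 1 := by
  induction L with
  | zero =>
    intro S r K P h hP hid
    choose! s hs using exists_signing (V := Fin n)
    refine ⟨fun x i => s (P x i), h.map fun _ t => (t.1, s t.2), fun x i => hs _ (hP x i),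
      fun x k => ?_⟩
    have hn : 0 < n := k.pos
    -- At the root only processor 0 still holds trails, so the sum is a single signing.
    rw [Finset.sum_eq_single ⟨0, hn⟩]
    · have := (hs _ (hP x ⟨0, hn⟩)).mem k
      rw [Finset.mem_Icc] at this
      exact abs_le.2 this
    · intro i _ hi
      refine (hs _ (hP x i)).eq_zero ?_
      rw [hid x i]
      · rfl
      · rw [pow_zero, Nat.one_le_iff_ne_zero]
        exact fun h0 => hi (Fin.ext h0)
    · simp
  | succ L ih =>
    intro S r K P h hP hid
    choose! q hq hqid s₁ s₂ hs₁ hs₂ hs using exists_merge (V := Fin n)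
    -- An involution has `n` values, too many for one link. Processor `i` sends its value at `l` to
    -- the relay `l`, which forwards to each `j` the two values of the children of `j`: `n * n`
    -- possible messages.
    have h₁ := h.exchange Finset.univ (by simpa using le_trans (Nat.le_mul_self n) hb)
      (fun _ t l => t.2 l) fun _ _ _ => Finset.mem_univ _
    have h₂ := h₁.exchange Finset.univ (by simpa using hb)
      (fun l t j => (extendFin t.2 l (2 * j), extendFin t.2 l (2 * j + 1)))
      fun _ _ _ => Finset.mem_univ _
    -- The default `l` gives a missing child the identity.
    let C₁ : X → Fin n → Fin n → Fin n := fun x j l => extendFin (fun i => P x i l) l (2 * j)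
    let C₂ : X → Fin n → Fin n → Fin n := fun x j l => extendFin (fun i => P x i l) l (2 * j + 1)
    have hC : ∀ x m, (∃ h : m < n, (fun l => extendFin (fun i => P x i l) l m) = P x ⟨m, h⟩) ∨
        (fun l => extendFin (fun i => P x i l) l m) = id := by
      intro x m
      by_cases hm : m < n
      · exact Or.inl ⟨hm, funext fun l => by simp [extendFin, hm]⟩
      · exact Or.inr (funext fun l => by simp [extendFin, hm])
    have hinv : ∀ x m, Function.Involutive fun l => extendFin (fun i => P x i l) l m := by
      intro x m
      rcases hC x m with ⟨_, e⟩ | e <;> rw [e]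
      · exact hP _ _
      · exact fun _ => rfl
    have hCid : ∀ x m, 2 ^ (L + 1) ≤ m → (fun l => extendFin (fun i => P x i l) l m) = id := by
      intro x m hm
      rcases hC x m with ⟨hm', e⟩ | e
      · rw [e, hid x _ hm]
      · exact e
    have h₃ : RankKnows b N inp π (r + 2) fun x j =>
        ((K x j, C₁ x j, C₂ x j), q (C₁ x j) (C₂ x j)) :=
      h₂.map fun _ t => ((t.1.1.1, (fun l => (t.2 l).1), fun l => (t.2 l).2),
        q (fun l => (t.2 l).1) fun l => (t.2 l).2)
    obtain ⟨τ, h₄, hτ, hsum⟩ := ih h₃ (fun x j => hq _ _ (hinv x _) (hinv x _)) fun x j hj =>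
      hqid _ _ (hinv x _) (hinv x _) (hCid x _ (by rw [pow_succ]; omega))
        (hCid x _ (by rw [pow_succ]; omega))
    let A : X → Fin n → Fin n → ℤ := fun x j => s₁ (C₁ x j) (C₂ x j) (τ x j)
    let B : X → Fin n → Fin n → ℤ := fun x j => s₂ (C₁ x j) (C₂ x j) (τ x j)
    have hA : ∀ x j, Signing (C₁ x j) (A x j) := fun x j =>
      hs₁ _ _ (hinv x _) (hinv x _) _ (hτ x j)
    have hB : ∀ x j, Signing (C₂ x j) (B x j) := fun x j =>
      hs₂ _ _ (hinv x _) (hinv x _) _ (hτ x j)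
    have hAB : ∀ x j k, A x j k + B x j k = τ x j k := fun x j k =>
      hs _ _ (hinv x _) (hinv x _) _ (hτ x j) k
    -- The relays carry the signs back: first a pair from `{-1, 0, 1}`, hence the 9, then a single
    -- sign.
    have h₅ : RankKnows b N inp π _ fun x l => (K x l, fun j => (A x j l, B x j l)) :=
      (h₄.exchange (Finset.Icc (-1) 1 ×ˢ Finset.Icc (-1) 1) (by simpa using hb')
        (fun _ t l => (s₁ t.1.2.1 t.1.2.2 t.2 l, s₂ t.1.2.1 t.1.2.2 t.2 l))
        fun x j l => Finset.mem_product.2 ⟨(hA x j).mem l, (hB x j).mem l⟩).map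
          fun _ t => (t.1.1.1, t.2)
    let half : Fin n → Fin n := fun i => ⟨i / 2, lt_of_le_of_lt (Nat.div_le_self _ _) i.2⟩
    let σ : X → Fin n → Fin n → ℤ := fun x i l =>
      if i.val % 2 = 0 then A x (half i) l else B x (half i) l
    have h₆ : RankKnows b N inp π _ fun x i => (K x i, σ x i) :=
      (h₅.exchange (Finset.Icc (-1) 1) (by simpa using le_trans (by norm_num) hb')
        (fun _ t i => if i.val % 2 = 0 then (t.2 (half i)).1 else (t.2 (half i)).2)
        fun x l i => by
          dsimp only
          split_ifs
          · exact (hA x _).mem l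
          · exact (hB x _).mem l).map fun _ t => (t.1.1, t.2)
    refine ⟨σ, ?_, fun x i => ?_, fun x k => ?_⟩
    · convert h₆ using 1
      ring
    · rcases Nat.mod_two_eq_zero_or_one i.val with hi | hi
      · have e : C₁ x (half i) = P x i := by
          funext l
          have : 2 * (i.val / 2) = i.val := by omega
          simp [C₁, half, extendFin, this]
        have e' : σ x i = A x (half i) := funext fun l => by simp [σ, hi]
        rw [e', ← e]
        exact hA x _
      · have e : C₂ x (half i) = P x i := by
          funext l
          have : 2 * (i.val / 2) + 1 = i.val := by omega
          simp [C₂, half, extendFin, this]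
        have e' : σ x i = B x (half i) := funext fun l => by simp [σ, hi]
        rw [e', ← e]
        exact hB x _
    · have e : ∑ i, σ x i k = ∑ j, τ x j k := by
        rw [sum_fin_eq_sum_children]
        refine Finset.sum_congr rfl fun j _ => ?_
        rw [← hAB]
        congr 1
        · by_cases hj : 2 * j.val < n
          · simp [extendFin, hj, σ, half]
          · rw [(hA x j).eq_zero (by simp [C₁, extendFin, hj])]
            simp [extendFin, hj]
        · by_cases hj : 2 * j.val + 1 < n
          · have e' : (2 * j.val + 1) / 2 = j.val := by omega
            have e'' : (2 * j.val + 1) % 2 = 1 := by omega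
            simp [extendFin, hj, σ, half, e', e'']
          · rw [(hB x j).eq_zero (by simp [C₂, extendFin, hj])]
            simp [extendFin, hj]
      rw [e]
      exact hsum x k

/-! ### Rounding integer matrices -/

/-- The `k`-th row sum minus the `k`-th column sum. -/
def netSum (Z : Fin n → Fin n → ℤ) (k : Fin n) : ℤ := ∑ w, Z k w - ∑ u, Z u k

/-- Processors that know the rows of a matrix of multiples of `2 ^ j` can change each entry by at
most `2 ^ j` into a multiple of `2 ^ (j + 1)`, without increasing the cost. -/
theorem exists_doubled [NeZero n] (hb : n * n ≤ 2 ^ b) (hb' : 9 ≤ 2 ^ b) (m : ℕ)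
    (hm : 2 * (n * m) + 1 ≤ 2 ^ b) {L : ℕ} (hL : n ≤ 2 ^ L) (j : ℕ) {S : Type}
    {K : X → Fin n → S} {Z c : X → Fin n → Fin n → ℤ}
    (h : RankKnows b N inp π r fun x k => (K x k, Z x k, c x k))
    (hc : ∀ x k w, |c x k w| ≤ m) (hZ : ∀ x k w, 2 ^ j ∣ Z x k w) :
    ∃ Z' : X → Fin n → Fin n → ℤ,
      RankKnows b N inp π (r + (4 * L + 1)) (fun x k => (K x k, Z' x k, c x k)) ∧
      ∀ x, (∀ k w, 2 ^ (j + 1) ∣ Z' x k w) ∧ (∀ k w, |Z' x k w - Z x k w| ≤ 2 ^ j) ∧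
        (∀ k, 2 ^ (j + 1) ∣ netSum (Z x) k → netSum (Z' x) k = netSum (Z x) k) ∧
        ∑ k, ∑ w, c x k w * Z' x k w ≤ ∑ k, ∑ w, c x k w * Z x k w := by
  -- The star of `i` is inserted into the empty family `id`, whose only signing is 0; so `τ` is
  -- exactly the net outflow of the directed star.
  have hstar : ∀ (i : Fin n) (T : Finset (Fin n)), ∃ q : Fin n → Fin n, Function.Involutive q ∧
      ∀ τ, Signing q τ → ∃ ε : Fin n → ℤ, (∀ w, ε w = 1 ∨ ε w = -1) ∧
        ∀ k, τ k = ∑ w ∈ T, ε w * unitNet i w k := by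
    intro i T
    obtain ⟨q, hq, hq'⟩ := exists_insert_edges id (fun _ => rfl) (fun _ => i) id T
    refine ⟨q, hq, fun τ hτ => ?_⟩
    obtain ⟨ε, hε, hs⟩ := hq' τ hτ
    exact ⟨ε, hε, fun k => sub_eq_zero.1 (hs.eq_zero rfl)⟩
  choose! q hq ε hε hεsum using hstar
  let odd : (Fin n → ℤ) → Finset (Fin n) := fun z =>
    Finset.univ.filter fun w => ¬ (2 ^ (j + 1) : ℤ) ∣ z w
  obtain ⟨σ, h₁, hσ, hσsum⟩ := exists_signings hb hb' L
    (h.map fun k t => (t, q k (odd t.2.1))) (fun x i => hq i _)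
    fun x i hi => absurd (i.2.trans_le hL) hi.not_gt
  let row : Fin n → (Fin n → ℤ) → (Fin n → ℤ) → Fin n → ℤ := fun k z s w =>
    if w ∈ odd z then ε k (odd z) s w else 0
  let y : X → Fin n → Fin n → ℤ := fun x k => row k (Z x k) (σ x k)
  have hy : ∀ x k w, (y x k w = 1 ∨ y x k w = -1) ∧ ¬ (2 ^ (j + 1) : ℤ) ∣ Z x k w ∨
      y x k w = 0 ∧ (2 ^ (j + 1) : ℤ) ∣ Z x k w := by
    intro x k w
    by_cases hw : (2 ^ (j + 1) : ℤ) ∣ Z x k w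
    · exact Or.inr ⟨by simp [y, row, odd, hw], hw⟩
    · refine Or.inl ⟨?_, hw⟩
      simpa [y, row, odd, hw] using hε k _ _ (hσ x k) w
  have hyabs : ∀ x k w, |y x k w| ≤ 1 := by
    intro x k w
    rcases hy x k w with ⟨h | h, -⟩ | ⟨h, -⟩ <;> simp [h]
  have hnet : ∀ x k, |netSum (y x) k| ≤ 1 := by
    intro x k
    -- Every odd edge lies in exactly one star, that of its tail.
    have e : netSum (y x) k = ∑ i, σ x i k := by
      have e₁ : ∀ i, σ x i k = ∑ w, y x i w * unitNet i w k := fun i => by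
        rw [hεsum i _ _ (hσ x i) k]
        simp only [y, row, ite_mul, zero_mul, Finset.sum_ite_mem, Finset.univ_inter]
      simp only [e₁, unitNet, netSum, mul_sub, Finset.sum_sub_distrib]
      congr 1
      · rw [Finset.sum_comm]
        simp
      · simp
    rw [e]
    exact hσsum x k
  have hcy : ∀ x k, |∑ w, c x k w * y x k w| ≤ (n * m : ℕ) := by
    intro x k
    refine (Finset.abs_sum_le_sum_abs _ _).trans ?_
    refine (Finset.sum_le_card_nsmul _ _ (m : ℤ) fun w _ => ?_).trans (by simp)
    rw [abs_mul]
    exact (mul_le_mul (hc x k w) (hyabs x k w) (abs_nonneg _) (by positivity)).trans (by simp)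
  have h₂ : RankKnows b N inp π (r + 4 * L) fun x k => ((K x k, Z x k, c x k), y x k) :=
    h₁.map fun k t => (t.1, row k t.1.2.1 t.2)
  -- Each processor broadcasts the cost change of its row, one of `2 * (n * m) + 1` integers; all
  -- then compute the same global sign.
  have h₃ := h₂.exchange (Finset.Icc (-(n * m : ℕ)) (n * m : ℕ) : Finset ℤ)
    (by
      rw [Int.card_Icc]
      refine le_trans (le_of_eq ?_) hm
      omega)
    (fun _ t _ => ∑ w, t.1.2.2 w * t.2 w)
    fun x k _ => Finset.mem_Icc.2 (abs_le.1 (hcy x k))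
  let sgn : ℤ → ℤ := fun a => if a ≤ 0 then 1 else -1
  have hsgn : ∀ a, sgn a = 1 ∨ sgn a = -1 := fun a => by
    by_cases ha : a ≤ 0 <;> simp [sgn, ha]
  have hsgn' : ∀ a, sgn a * a ≤ 0 := fun a => by
    by_cases ha : a ≤ 0
    · simp [sgn, ha]
    · simp only [sgn, ha, if_false]
      omega
  let Z' : X → Fin n → Fin n → ℤ := fun x k w =>
    Z x k w + 2 ^ j * (sgn (∑ l, ∑ w, c x l w * y x l w) * y x k w)
  have h₄ : RankKnows b N inp π (r + 4 * L + 1) fun x k => (K x k, Z' x k, c x k) :=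
    h₃.map fun _ t => (t.1.1.1, (fun w => t.1.1.2.1 w + 2 ^ j * (sgn (∑ l, t.2 l) * t.1.2 w)),
      t.1.1.2.2)
  refine ⟨Z', h₄, fun x => ?_⟩
  obtain ⟨s, hs⟩ : ∃ s, s = sgn (∑ l, ∑ w, c x l w * y x l w) := ⟨_, rfl⟩
  have hs1 : s = 1 ∨ s = -1 := hs ▸ hsgn _
  have hZ' : ∀ k w, Z' x k w = Z x k w + 2 ^ j * (s * y x k w) := fun k w => by rw [hs]
  have hdvd : ∀ k w, (2 ^ (j + 1) : ℤ) ∣ Z x k w - 2 ^ j * y x k w := by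
    intro k w
    obtain ⟨a, ha⟩ := hZ x k w
    rw [ha, ← mul_sub, pow_succ]
    refine mul_dvd_mul_left _ ?_
    rcases hy x k w with ⟨h1, h2⟩ | ⟨h1, h2⟩
    · rw [ha, pow_succ, mul_dvd_mul_iff_left (by positivity)] at h2
      rcases h1 with h1 | h1 <;> omega
    · rw [ha, pow_succ, mul_dvd_mul_iff_left (by positivity)] at h2
      rw [h1, sub_zero]
      exact h2
  -- Modulo `2 ^ (j + 1)` the global sign is irrelevant.
  have hdvd' : ∀ a : ℤ, (2 ^ (j + 1) : ℤ) ∣ 2 ^ j * a + 2 ^ j * (s * a) := by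
    intro a
    rw [← mul_add, pow_succ]
    refine mul_dvd_mul_left _ ?_
    rcases hs1 with rfl | rfl
    · exact ⟨a, by ring⟩
    · exact ⟨0, by ring⟩
  have hnetZ' : ∀ k, netSum (Z' x) k = netSum (Z x) k + 2 ^ j * (s * netSum (y x) k) := by
    intro k
    simp only [netSum, hZ', Finset.sum_add_distrib, ← Finset.mul_sum]
    ring
  refine ⟨fun k w => ?_, fun k w => ?_, fun k hk => ?_, ?_⟩
  · rw [hZ', show Z x k w + 2 ^ j * (s * y x k w) = (Z x k w - 2 ^ j * y x k w) +
      (2 ^ j * y x k w + 2 ^ j * (s * y x k w)) by ring]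
    exact dvd_add (hdvd k w) (hdvd' _)
  · rw [hZ', add_sub_cancel_left, abs_mul, abs_mul, abs_of_pos (by positivity : (0 : ℤ) < 2 ^ j)]
    have : |s| = 1 := by rcases hs1 with h | h <;> simp [h]
    rw [this, one_mul]
    exact mul_le_of_le_one_right (by positivity) (hyabs x k w)
  -- Here the net sum of `y` is even and at most 1 in absolute value, hence 0.
  · have h1 : (2 ^ (j + 1) : ℤ) ∣ netSum (Z x) k - 2 ^ j * netSum (y x) k := by
      have : netSum (Z x) k - 2 ^ j * netSum (y x) k =
          ∑ w, (Z x k w - 2 ^ j * y x k w) - ∑ u, (Z x u k - 2 ^ j * y x u k) := by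
        simp only [netSum, Finset.sum_sub_distrib, ← Finset.mul_sum]
        ring
      rw [this]
      exact dvd_sub (Finset.dvd_sum fun _ _ => hdvd _ _) (Finset.dvd_sum fun _ _ => hdvd _ _)
    have h2 : (2 ^ j * 2 : ℤ) ∣ 2 ^ j * netSum (y x) k := by
      rw [← pow_succ]
      exact (dvd_sub_right hk).1 h1
    rw [mul_dvd_mul_iff_left (by positivity)] at h2
    have h3 := abs_le.1 (hnet x k)
    have h4 : netSum (y x) k = 0 := by omega
    rw [hnetZ', h4]
    ring
  · have : ∑ k, ∑ w, c x k w * Z' x k w = ∑ k, ∑ w, c x k w * Z x k w +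
        2 ^ j * (s * ∑ k, ∑ w, c x k w * y x k w) := by
      simp only [hZ', Finset.mul_sum, ← Finset.sum_add_distrib]
      exact Finset.sum_congr rfl fun _ _ => Finset.sum_congr rfl fun _ _ => by ring
    rw [this]
    have h1 := hs ▸ hsgn' (∑ k, ∑ w, c x k w * y x k w)
    have h2 : (2 ^ j : ℤ) * (s * ∑ k, ∑ w, c x k w * y x k w) ≤ 0 :=
      mul_nonpos_of_nonneg_of_nonpos (by positivity) h1
    linarith

/-- Processors that know the rows of an integer matrix can round its entries to multiples of
`2 ^ j`, without increasing the cost. -/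
theorem exists_rounded [NeZero n] (hb : n * n ≤ 2 ^ b) (hb' : 9 ≤ 2 ^ b) (m : ℕ)
    (hm : 2 * (n * m) + 1 ≤ 2 ^ b) {L : ℕ} (hL : n ≤ 2 ^ L) (j : ℕ) {S : Type}
    {K : X → Fin n → S} {Z c : X → Fin n → Fin n → ℤ}
    (h : RankKnows b N inp π r fun x k => (K x k, Z x k, c x k))
    (hc : ∀ x k w, |c x k w| ≤ m) :
    ∃ Z' : X → Fin n → Fin n → ℤ,
      RankKnows b N inp π (r + j * (4 * L + 1)) (fun x k => (K x k, Z' x k, c x k)) ∧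
      ∀ x, (∀ k w, 2 ^ j ∣ Z' x k w) ∧ (∀ k w, |Z' x k w - Z x k w| < 2 ^ j) ∧
        (∀ k, 2 ^ j ∣ netSum (Z x) k → netSum (Z' x) k = netSum (Z x) k) ∧
        ∑ k, ∑ w, c x k w * Z' x k w ≤ ∑ k, ∑ w, c x k w * Z x k w := by
  induction j with
  | zero => exact ⟨Z, by simpa using h, fun x => ⟨by simp, by simp, fun _ _ => rfl, le_rfl⟩⟩
  | succ j ih =>
    obtain ⟨Z₁, h₁, H₁⟩ := ih
    obtain ⟨Z₂, h₂, H₂⟩ := exists_doubled hb hb' m hm hL j h₁ hc fun x => (H₁ x).1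
    refine ⟨Z₂, by convert h₂ using 1; ring, fun x => ⟨(H₂ x).1, fun k w => ?_, fun k hk => ?_,
      (H₂ x).2.2.2.trans (H₁ x).2.2.2⟩⟩
    -- The errors add up: less than `2 ^ j` before, at most `2 ^ j` now.
    · have e₁ := abs_lt.1 ((H₁ x).2.1 k w)
      have e₂ := abs_le.1 ((H₂ x).2.1 k w)
      rw [abs_lt, pow_succ]
      constructor <;> linarith
    · have e := (H₁ x).2.2.1 k ((pow_dvd_pow 2 j.le_succ).trans hk)
      rw [← e]
      exact (H₂ x).2.2.1 k (e ▸ hk)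

end Algorithm

/-! ### Rounding flows -/

section Rounding

variable {n : ℕ}

/-- The label of the edge whose other endpoint has the identifier `i`. -/
noncomputable def edgeLabel {L : Type} (T : Set (ℕ × L)) (i : ℕ) : Option L :=
  open scoped Classical in if h : ∃ a, (i, a) ∈ T then some h.choose else none

/-- The chosen label is unique because identifiers are distinct and an ordered pair carries at most
one edge. -/
theorem edgeLabel_outEdges {L : Type} (N : CliqueNetwork n) (E : Finset (Fin n × Fin n))
    (s t : Fin n) (label : Fin n × Fin n → L) (v u : Fin n) :
    edgeLabel (localInput N E s t label v).outEdges (N.id u) =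
      if (v, u) ∈ E then some (label (v, u)) else none := by
  have key : ∀ a, (N.id u, a) ∈ (localInput N E s t label v).outEdges ↔
      (v, u) ∈ E ∧ a = label (v, u) := fun a => by
    constructor
    · rintro ⟨w, hw, e⟩
      obtain ⟨e₁, rfl⟩ := Prod.mk.inj e
      obtain rfl := N.id_injective e₁
      exact ⟨hw, rfl⟩
    · rintro ⟨h, rfl⟩
      exact ⟨u, h, rfl⟩
  unfold edgeLabel
  by_cases h : (v, u) ∈ E
  · have h' : ∃ a, (N.id u, a) ∈ (localInput N E s t label v).outEdges := ⟨_, (key _).2 ⟨h, rfl⟩⟩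
    rw [dif_pos h', if_pos h, ((key _).1 h'.choose_spec).2]
  · rw [dif_neg fun ⟨a, ha⟩ => h ((key a).1 ha).1, if_neg h]

theorem edgeLabel_inEdges {L : Type} (N : CliqueNetwork n) (E : Finset (Fin n × Fin n))
    (s t : Fin n) (label : Fin n × Fin n → L) (v u : Fin n) :
    edgeLabel (localInput N E s t label v).inEdges (N.id u) =
      if (u, v) ∈ E then some (label (u, v)) else none := by
  have key : ∀ a, (N.id u, a) ∈ (localInput N E s t label v).inEdges ↔
      (u, v) ∈ E ∧ a = label (u, v) := fun a => by
    constructor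
    · rintro ⟨w, hw, e⟩
      obtain ⟨e₁, rfl⟩ := Prod.mk.inj e
      obtain rfl := N.id_injective e₁
      exact ⟨hw, rfl⟩
    · rintro ⟨h, rfl⟩
      exact ⟨u, h, rfl⟩
  unfold edgeLabel
  by_cases h : (u, v) ∈ E
  · have h' : ∃ a, (N.id u, a) ∈ (localInput N E s t label v).inEdges := ⟨_, (key _).2 ⟨h, rfl⟩⟩
    rw [dif_pos h', if_pos h, ((key _).1 h'.choose_spec).2]
  · rw [dif_neg fun ⟨a, ha⟩ => h ((key a).1 ha).1, if_neg h]

theorem sum_edges_eq_sum_sum (E : Finset (Fin n × Fin n)) (φ : Fin n × Fin n → ℝ) :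
    ∑ e ∈ E, φ e = ∑ u, ∑ w, if (u, w) ∈ E then φ (u, w) else 0 := by
  rw [← Fintype.sum_prod_type fun e => if e ∈ E then φ e else 0, Finset.sum_ite_mem,
    Finset.univ_inter]

theorem netOutflow_eq_netSum (E : Finset (Fin n × Fin n)) (π : Fin n ≃ Fin n)
    (Z : Fin n → Fin n → ℤ) (d : ℝ) (h : Fin n × Fin n → ℝ)
    (hE : ∀ u w, (u, w) ∈ E → h (u, w) = Z (π u) (π w) * d)
    (hE' : ∀ u w, (u, w) ∉ E → Z (π u) (π w) = 0) (v : Fin n) :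
    netOutflow E h v = netSum Z (π v) * d := by
  have e : ∀ u w, (if (u, w) ∈ E then h (u, w) else 0) = Z (π u) (π w) * d := fun u w => by
    split_ifs with hu
    · exact hE u w hu
    · simp [hE' u w hu]
  have e₁ : ∑ e ∈ E with e.1 = v, h e = ∑ w, Z (π v) (π w) * d := by
    rw [sum_edges_eq_sum_sum, Finset.sum_eq_single v]
    · simp [e]
    · intro u _ hu
      simp [hu]
    · simp
  have e₂ : ∑ e ∈ E with e.2 = v, h e = ∑ u, Z (π u) (π v) * d := by
    rw [sum_edges_eq_sum_sum]
    refine Finset.sum_congr rfl fun u _ => ?_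
    rw [Finset.sum_eq_single v]
    · simp [e]
    · intro w _ hw
      simp [hw]
    · simp
  have e₃ : netSum Z (π v) = ∑ w, Z (π v) (π w) - ∑ u, Z (π u) (π v) := by
    rw [Equiv.sum_comp π, Equiv.sum_comp π fun u => Z u (π v), netSum]
  rw [netOutflow, e₁, e₂, e₃]
  push_cast
  simp only [Finset.sum_mul, sub_mul]

theorem sum_cost_eq_sum_sum (E : Finset (Fin n × Fin n)) (π : Fin n ≃ Fin n)
    (Z : Fin n → Fin n → ℤ) (d : ℝ) (h : Fin n × Fin n → ℝ)
    (hE : ∀ u w, (u, w) ∈ E → h (u, w) = Z (π u) (π w) * d)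
    (hE' : ∀ u w, (u, w) ∉ E → Z (π u) (π w) = 0)
    (c : Fin n → Fin n → ℤ) (c' : Fin n × Fin n → ℤ)
    (hc : ∀ u w, (u, w) ∈ E → c (π u) (π w) = c' (u, w)) :
    ∑ e ∈ E, (c' e : ℝ) * h e = (∑ i, ∑ l, c i l * Z i l : ℤ) * d := by
  rw [sum_edges_eq_sum_sum, ← Equiv.sum_comp π fun i => ∑ l, c i l * Z i l]
  push_cast
  rw [Finset.sum_mul]
  refine Finset.sum_congr rfl fun u _ => ?_
  rw [← Equiv.sum_comp π fun l => (c (π u) l : ℝ) * Z (π u) l, Finset.sum_mul]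
  refine Finset.sum_congr rfl fun w _ => ?_
  split_ifs with hu
  · rw [hE u w hu, hc u w hu]
    ring
  · rw [hE' u w hu]
    simp

/-- The zero-round algorithm rounds down. -/
noncomputable def floorAlgorithm (n b : ℕ) {L : Type} (fl : L → ℝ) :
    CliqueAlgorithm n b (LocalInput L) LocalOutput where
  State := LocalInput L
  init := id
  send _ _ := ⟨[], Nat.zero_le b⟩
  receive σ _ := σ
  rounds := 0
  output σ :=
    { outFlow := fun i => (edgeLabel σ.outEdges i).elim 0 fun l => ⌊fl l⌋
      inFlow := fun i => (edgeLabel σ.inEdges i).elim 0 fun l => ⌊fl l⌋ }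

/-- The requirements on the rounding `g` of `f`, for a cost function `c` of any sign. -/
structure IsGoodRounding (E : Finset (Fin n × Fin n)) (f g : Fin n × Fin n → ℝ)
    (c : Fin n × Fin n → ℤ) : Prop where
  isRounding : IsRounding E f g
  netOutflow_eq : ∀ v, (∃ z : ℤ, netOutflow E f v = z) → netOutflow E g v = netOutflow E f v
  cost_le : ∑ e ∈ E, (c e : ℝ) * g e ≤ ∑ e ∈ E, (c e : ℝ) * f e

/-- The local inputs on which rounding to integers of multiples of `1 / 2 ^ k` is possible; the
cost of an edge depends on its label and on which endpoints are the source. -/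
structure RoundingInstance (n a k : ℕ) {L : Type} (fl : L → ℝ) (cost : Bool → Bool → L → ℤ) where
  N : CliqueNetwork n
  E : Finset (Fin n × Fin n)
  s : Fin n
  t : Fin n
  label : Fin n × Fin n → L
  id_lt : ∀ v, N.id v < n ^ a
  cost_le : ∀ e ∈ E, |cost (decide (e.1 = s)) (decide (e.2 = s)) (label e)| ≤ (n ^ a : ℕ)
  multiple : ∀ e ∈ E, ∃ z : ℤ, fl (label e) * 2 ^ k = z

namespace RoundingInstance

variable {a k : ℕ} {L : Type} {fl : L → ℝ} {cost : Bool → Bool → L → ℤ}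

/-- The local inputs. -/
def input (x : RoundingInstance n a k fl cost) : Fin n → LocalInput L :=
  localInput x.N x.E x.s x.t x.label

/-- The flow. -/
def flow (x : RoundingInstance n a k fl cost) (e : Fin n × Fin n) : ℝ := fl (x.label e)

/-- The cost of an edge. -/
def edgeCost (x : RoundingInstance n a k fl cost) (e : Fin n × Fin n) : ℤ :=
  cost (decide (e.1 = x.s)) (decide (e.2 = x.s)) (x.label e)

end RoundingInstance

/-- The number of rounds of the rounding algorithm. -/
def roundingRounds (n k : ℕ) : ℕ := if 2 ≤ n ∧ 1 ≤ k then k * (4 * Nat.clog 2 n + 1) + 2 else 0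

/-- These are the cases where the round bound leaves no communication. For `k = 0` the flow is
already integral. For `n < 2` all edges are loops: they have no net outflow, and `hcost` makes
rounding down cheap. -/
theorem floorAlgorithm_spec {a k b : ℕ} (hnk : ¬(2 ≤ n ∧ 1 ≤ k)) {L : Type} (fl : L → ℝ)
    (cost : Bool → Bool → L → ℤ) (hcost : ∀ β l, 0 ≤ cost β β l)
    (x : RoundingInstance n a k fl cost) :
    ∃ g, Outputs x.N x.E ((floorAlgorithm n b fl).run x.N x.input) g ∧
      IsGoodRounding x.E x.flow g x.edgeCost := by
  have hk : 2 ≤ n → ∀ e ∈ x.E, (⌊x.flow e⌋ : ℝ) = x.flow e := by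
    intro hn e he
    obtain rfl : k = 0 := by omega
    obtain ⟨z, hz⟩ := x.multiple e he
    rw [pow_zero, mul_one] at hz
    rw [RoundingInstance.flow, hz, Int.floor_intCast]
  refine ⟨fun e => ⌊x.flow e⌋, fun e he => ⟨?_, ?_⟩, ⟨fun e _ => Or.inl rfl, ?_, ?_⟩⟩
  · change (edgeLabel (localInput x.N x.E x.s x.t x.label e.1).outEdges (x.N.id e.2)).elim 0 _ = _
    rw [edgeLabel_outEdges, if_pos he]
    rfl
  · change (edgeLabel (localInput x.N x.E x.s x.t x.label e.2).inEdges (x.N.id e.1)).elim 0 _ = _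
    rw [edgeLabel_inEdges, if_pos he]
    rfl
  · rcases Nat.lt_or_ge n 2 with hn | hn
    · have hss : Subsingleton (Fin n) := Fin.subsingleton_iff_le_one.2 (by omega)
      have h0 : ∀ (φ : Fin n × Fin n → ℝ) v, netOutflow x.E φ v = 0 := fun φ v => by
        simp [netOutflow, Subsingleton.elim _ v]
      exact fun v _ => by rw [h0, h0]
    · intro v _
      exact congrArg₂ (· - ·) (Finset.sum_congr rfl fun e he => hk hn e (Finset.mem_filter.1 he).1)
        (Finset.sum_congr rfl fun e he => hk hn e (Finset.mem_filter.1 he).1)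
  · refine Finset.sum_le_sum fun e he => ?_
    rcases Nat.lt_or_ge n 2 with hn | hn
    · have hss : Subsingleton (Fin n) := Fin.subsingleton_iff_le_one.2 (by omega)
      have hc : 0 ≤ x.edgeCost e := by
        rw [RoundingInstance.edgeCost, Subsingleton.elim e.1 e.2]
        exact hcost _ _
      exact mul_le_mul_of_nonneg_left (Int.floor_le _) (by exact_mod_cast hc)
    · rw [hk hn e he]

theorem exists_rounding_algorithm (n a k b : ℕ) {L : Type} (fl : L → ℝ)
    (cost : Bool → Bool → L → ℤ) (hn : 2 ≤ n) (hb : n * n ≤ 2 ^ b) (hb' : 9 ≤ 2 ^ b)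
    (hm : 2 * (n * n ^ a) + 1 ≤ 2 ^ b) :
    ∃ A : CliqueAlgorithm n b (LocalInput L) LocalOutput,
      A.rounds = k * (4 * Nat.clog 2 n + 1) + 2 ∧
      ∀ x : RoundingInstance n a k fl cost, ∃ g, Outputs x.N x.E (A.run x.N x.input) g ∧
        IsGoodRounding x.E x.flow g x.edgeCost := by
  have : NeZero n := ⟨by omega⟩
  obtain ⟨π, h₀⟩ := exists_rankKnows (b := b) (N := RoundingInstance.N)
    (inp := RoundingInstance.input (a := a) (k := k) (fl := fl) (cost := cost)) LocalInput.id
    LocalInput.isSource (n ^ a) (by nlinarith [Nat.pow_pos (n := a) (by omega : 0 < n)])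
    (fun _ _ => rfl) RoundingInstance.id_lt
  -- the rows of the flow, in units of `1 / 2 ^ k`, and of the costs
  let Zrow : LocalInput L → (Fin n → ℕ) → Fin n → ℤ := fun σ ids l =>
    (edgeLabel σ.outEdges (ids l)).elim 0 fun lab => ⌊fl lab * 2 ^ k⌋
  let crow : LocalInput L → (Fin n → ℕ) → (Fin n → Bool) → Fin n → ℤ := fun σ ids β l =>
    (edgeLabel σ.outEdges (ids l)).elim 0 fun lab => cost σ.isSource (β l) lab
  let Z : RoundingInstance n a k fl cost → Fin n → Fin n → ℤ := fun x i =>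
    Zrow (x.input ((π x).symm i)) fun l => x.N.id ((π x).symm l)
  let c : RoundingInstance n a k fl cost → Fin n → Fin n → ℤ := fun x i =>
    crow (x.input ((π x).symm i)) (fun l => x.N.id ((π x).symm l))
      fun l => (x.input ((π x).symm l)).isSource
  have hZ : ∀ x u w, Z x (π x u) (π x w) = if (u, w) ∈ x.E then ⌊x.flow (u, w) * 2 ^ k⌋ else 0 := by
    intro x u w
    simp only [Z, Zrow, RoundingInstance.input, Equiv.symm_apply_apply, edgeLabel_outEdges]
    split_ifs <;> rfl
  have hc : ∀ x u w, c x (π x u) (π x w) = if (u, w) ∈ x.E then x.edgeCost (u, w) else 0 := by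
    intro x u w
    simp only [c, crow, RoundingInstance.input, Equiv.symm_apply_apply, edgeLabel_outEdges]
    split_ifs <;> rfl
  have hcm : ∀ x i l, |c x i l| ≤ (n ^ a : ℕ) := by
    intro x i l
    obtain ⟨u, rfl⟩ := (π x).surjective i
    obtain ⟨w, rfl⟩ := (π x).surjective l
    rw [hc]
    split_ifs with h
    · exact x.cost_le _ h
    · simp
  obtain ⟨Z', h₁, H⟩ := exists_rounded (Z := Z) (c := c) hb hb' (n ^ a) hm
    (Nat.le_pow_clog one_lt_two n) k
    (h₀.map fun _ t => (t, Zrow t.1 t.2.1, crow t.1 t.2.1 t.2.2)) hcm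
  -- Only the tail knows the rounded edge; one bit, up or not, informs the head.
  have h₂ : RankKnows b RoundingInstance.N RoundingInstance.input π _
      fun (x : RoundingInstance n a k fl cost) i =>
        (((x.input ((π x).symm i), (fun l => x.N.id ((π x).symm l)),
          fun l => (x.input ((π x).symm l)).isSource), Z' x i, c x i),
          fun l => decide (Z x l i < Z' x l i)) := h₁.exchange Finset.univ (by simpa using le_trans (by norm_num) hb')
    (fun _ t l => decide (Zrow t.1.1 t.1.2.1 l < t.2.1 l)) fun _ _ _ => Finset.mem_univ _
  classical
  let rnd : Bool → ℝ → ℝ := fun up y => if up then ⌈y⌉ else ⌊y⌋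
  let out : (LocalInput L × (Fin n → ℕ) × (Fin n → Bool)) → (Fin n → ℤ) → (Fin n → Bool) →
      LocalOutput := fun t z up =>
    { outFlow := fun i => (edgeLabel t.1.outEdges i).elim 0 fun lab =>
        rnd (decide (Zrow t.1 t.2.1 (Function.invFun t.2.1 i) < z (Function.invFun t.2.1 i))) (fl lab)
      inFlow := fun i => (edgeLabel t.1.inEdges i).elim 0 fun lab =>
        rnd (up (Function.invFun t.2.1 i)) (fl lab) }
  have h₃ : Knows b RoundingInstance.N RoundingInstance.input _
      fun (x : RoundingInstance n a k fl cost) v =>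
        out (x.input ((π x).symm (π x v)), (fun l => x.N.id ((π x).symm l)),
          fun l => (x.input ((π x).symm l)).isSource) (Z' x (π x v))
          fun l => decide (Z x l (π x v) < Z' x l (π x v)) := Knows.map h₂ fun s => out s.2.1.1 s.2.1.2.1 s.2.2
  obtain ⟨A, hA, hrun⟩ := h₃.exists_algorithm
  refine ⟨A, by rw [hA]; ring, fun x => ?_⟩
  let g : Fin n × Fin n → ℝ := fun e =>
    rnd (decide (Z x (π x e.1) (π x e.2) < Z' x (π x e.1) (π x e.2))) (x.flow e)
  have hinv : ∀ u, Function.invFun (fun l => x.N.id ((π x).symm l)) (x.N.id u) = π x u := by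
    intro u
    have hinj : Function.Injective fun l => x.N.id ((π x).symm l) :=
      x.N.id_injective.comp (π x).symm.injective
    have := Function.leftInverse_invFun hinj (π x u)
    simpa using this
  obtain ⟨H₁, H₂, H₃, H₄⟩ := H x
  have hd : (0 : ℝ) < 2 ^ k := by positivity
  have hZf : ∀ u w, (u, w) ∈ x.E → x.flow (u, w) = Z x (π x u) (π x w) * (1 / 2 ^ k : ℝ) := by
    intro u w h
    obtain ⟨z, hz⟩ := x.multiple _ h
    have : x.flow (u, w) * 2 ^ k = z := hz
    rw [hZ, if_pos h, this, Int.floor_intCast, ← this]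
    field_simp
  have hZ0 : ∀ u w, (u, w) ∉ x.E → Z x (π x u) (π x w) = 0 := fun u w h => by rw [hZ, if_neg h]
  -- Off the edges the entry is a multiple of `2 ^ k` of absolute value less than `2 ^ k`.
  have hZ'0 : ∀ u w, (u, w) ∉ x.E → Z' x (π x u) (π x w) = 0 := fun u w h => by
    have e := H₂ (π x u) (π x w)
    rw [hZ0 u w h, sub_zero] at e
    exact Int.eq_zero_of_abs_lt_dvd (H₁ _ _) e
  -- A multiple of `2 ^ k` at distance less than `2 ^ k` is the ceiling if it lies above and the
  -- floor otherwise, in units of `2 ^ k`.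
  have hg : ∀ u w, (u, w) ∈ x.E → g (u, w) = Z' x (π x u) (π x w) * (1 / 2 ^ k : ℝ) := by
    intro u w h
    obtain ⟨m, hm⟩ := H₁ (π x u) (π x w)
    have e := abs_lt.1 (H₂ (π x u) (π x w))
    have hf := hZf u w h
    simp only [g, rnd, decide_eq_true_eq]
    generalize Z x (π x u) (π x w) = z at *
    generalize Z' x (π x u) (π x w) = z' at *
    have hm' : (z' : ℝ) * (1 / 2 ^ k) = m := by
      rw [hm]
      push_cast
      field_simp
    have e₁ : (z : ℝ) - 2 ^ k < z' := by
      have : z - 2 ^ k < z' := by linarith [e.1]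
      exact_mod_cast this
    have e₂ : (z' : ℝ) < z + 2 ^ k := by
      have : z' < z + 2 ^ k := by linarith [e.2]
      exact_mod_cast this
    have hz : (z : ℝ) = x.flow (u, w) * 2 ^ k := by
      rw [hf]
      field_simp
    have hz' : (z' : ℝ) = m * 2 ^ k := by
      rw [hm]
      push_cast
      ring
    rw [hm']
    rw [hz, hz'] at e₁ e₂
    split_ifs with hlt
    · have hlt' : (z : ℝ) < z' := by exact_mod_cast hlt
      rw [hz, hz'] at hlt'
      norm_cast
      rw [Int.ceil_eq_iff]
      constructor <;> nlinarith
    · have hlt' : (z' : ℝ) ≤ z := by exact_mod_cast not_lt.1 hlt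
      rw [hz, hz'] at hlt'
      norm_cast
      rw [Int.floor_eq_iff]
      constructor <;> nlinarith
  refine ⟨g, fun e he => ⟨?_, ?_⟩, ⟨fun e _ => ?_, fun v hv => ?_, ?_⟩⟩
  · rw [hrun]
    simp only [out, hinv, Equiv.symm_apply_apply]
    rw [RoundingInstance.input, edgeLabel_outEdges, if_pos he]
    simp only [g, Z, Equiv.symm_apply_apply]
    rfl
  · rw [hrun]
    simp only [out, hinv, Equiv.symm_apply_apply]
    rw [RoundingInstance.input, edgeLabel_inEdges, if_pos he]
    rfl
  · simp only [g, rnd]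
    split_ifs
    · exact Or.inr rfl
    · exact Or.inl rfl
  · rw [netOutflow_eq_netSum x.E (π x) (Z x) _ _ hZf hZ0] at hv ⊢
    obtain ⟨z, hz⟩ := hv
    have hdvd : 2 ^ k ∣ netSum (Z x) (π x v) := by
      refine ⟨z, ?_⟩
      have : (netSum (Z x) (π x v) : ℝ) = 2 ^ k * z := by
        rw [← hz]
        field_simp
      exact_mod_cast this
    rw [netOutflow_eq_netSum x.E (π x) (Z' x) _ _ hg hZ'0, H₃ _ hdvd]
  · have hce : ∀ u w, (u, w) ∈ x.E → c x (π x u) (π x w) = x.edgeCost (u, w) := fun u w h => by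
      rw [hc, if_pos h]
    rw [sum_cost_eq_sum_sum x.E (π x) (Z x) _ _ hZf hZ0 _ _ hce,
      sum_cost_eq_sum_sum x.E (π x) (Z' x) _ _ hg hZ'0 _ _ hce]
    exact mul_le_mul_of_nonneg_right (by exact_mod_cast H₄) (by positivity)

end Rounding

/-! ### Message size, round bound and the choice of costs. -/

section Main

theorem message_bounds {n : ℕ} (hn : 2 ≤ n) (a : ℕ) :
    n * n ≤ 2 ^ ((a + 4) * Nat.clog 2 n) ∧ 9 ≤ 2 ^ ((a + 4) * Nat.clog 2 n) ∧
      2 * (n * n ^ a) + 1 ≤ 2 ^ ((a + 4) * Nat.clog 2 n) := by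
  have h : n ^ (a + 4) ≤ 2 ^ ((a + 4) * Nat.clog 2 n) := by
    rw [mul_comm, pow_mul]
    exact Nat.pow_le_pow_left (Nat.le_pow_clog one_lt_two n) _
  have ha : 1 ≤ n ^ a := Nat.one_le_pow _ _ (by omega)
  have h2 : 4 ≤ n * n := Nat.mul_le_mul hn hn
  have e : n ^ (a + 4) = n ^ a * ((n * n) * (n * n)) := by ring
  have h4 : 16 ≤ (n * n) * (n * n) := Nat.mul_le_mul h2 h2
  have h5 : (n * n) * (n * n) ≤ n ^ (a + 4) := e ▸ Nat.le_mul_of_pos_left _ ha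
  refine ⟨(Nat.le_mul_self _).trans (h5.trans h), (by omega : 9 ≤ _).trans (h5.trans h),
    le_trans ?_ h⟩
  rw [e]
  have h6 : n * n ^ a * 8 ≤ n ^ a * (n * n * (n * n)) := by
    calc n * n ^ a * 8 ≤ n * n ^ a * (n * (n * n)) :=
          Nat.mul_le_mul_left _ (by nlinarith)
      _ = _ := by ring
  have h7 : 1 ≤ n * n ^ a := Nat.mul_pos (by omega) ha
  omega

theorem one_le_logStar {n : ℕ} (hn : 2 ≤ n) : 1 ≤ logStar n := by
  -- Without nonemptiness `sInf` could be 0 by default.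
  have hne : ∀ m : ℕ, ∃ k, (Nat.clog 2)^[k] m ≤ 1 := by
    intro m
    induction m using Nat.strong_induction_on with
    | _ m ih =>
      rcases Nat.lt_or_ge 1 m with hm | hm
      · obtain ⟨k, hk⟩ := ih (Nat.clog 2 m)
          (lt_of_le_of_lt (Nat.clog_le_of_le_pow (y := m - 1)
            (by have := Nat.lt_two_pow_self (n := m - 1); omega)) (by omega))
        exact ⟨k + 1, by rwa [Function.iterate_succ_apply]⟩
      · exact ⟨0, hm⟩
  have h := Nat.sInf_mem (s := {k : ℕ | (Nat.clog 2)^[k] n ≤ 1}) (hne n)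
  rw [Nat.one_le_iff_ne_zero]
  intro h0
  change (Nat.clog 2)^[logStar n] n ≤ 1 at h
  rw [h0] at h
  simp only [Function.iterate_zero, id] at h
  omega

theorem roundingRounds_le {n : ℕ} (hn : 1 ≤ n) (k : ℕ) :
    (roundingRounds n k : ℝ) ≤ 11 * Real.logb 2 n * logStar n * k := by
  have hlog : 0 ≤ Real.logb 2 n := Real.logb_nonneg one_lt_two (by exact_mod_cast hn)
  unfold roundingRounds
  split_ifs with h
  · have h1 : 1 ≤ Real.logb 2 n := by
      rw [Real.le_logb_iff_rpow_le one_lt_two (by exact_mod_cast hn), Real.rpow_one]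
      exact_mod_cast h.1
    have h2 : (Nat.clog 2 n : ℝ) ≤ Real.logb 2 n + 1 := by
      have h2 := Nat.pow_pred_clog_lt_self one_lt_two (by omega : 1 < n)
      have h3 : ((Nat.clog 2 n).pred : ℝ) ≤ Real.logb 2 n := by
        rw [Real.le_logb_iff_rpow_le one_lt_two (by exact_mod_cast hn), Real.rpow_natCast]
        exact_mod_cast h2.le
      have h4 : (Nat.clog 2 n : ℝ) ≤ (Nat.clog 2 n).pred + 1 := by
        exact_mod_cast (by simp only [Nat.pred_eq_sub_one]; omega :
          Nat.clog 2 n ≤ (Nat.clog 2 n).pred + 1)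
      linarith
    have h3 : (1 : ℝ) ≤ logStar n := by exact_mod_cast one_le_logStar h.1
    have h4 : (1 : ℝ) ≤ k := by exact_mod_cast h.2
    push_cast
    -- The additive constants `4 + 1 + 2 = 7` are absorbed by `1 ≤ Real.logb 2 n`, which gives `4 +
    -- 7 = 11`.
    calc (k : ℝ) * (4 * Nat.clog 2 n + 1) + 2 ≤ k * (4 * (Real.logb 2 n + 1) + 1) + 2 * k := by
          gcongr
          linarith
      _ = (4 * Real.logb 2 n + 7) * k := by ring
      _ ≤ (11 * Real.logb 2 n * 1) * k := by gcongr; linarith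
      _ ≤ _ := by gcongr
  · simp only [Nat.cast_zero]
    positivity

theorem exists_algorithm (n a k : ℕ) {L : Type} (fl : L → ℝ) (cost : Bool → Bool → L → ℤ)
    (hcost : ∀ β l, 0 ≤ cost β β l) :
    ∃ A : CliqueAlgorithm n ((a + 4) * Nat.clog 2 n) (LocalInput L) LocalOutput,
      A.rounds = roundingRounds n k ∧
      ∀ x : RoundingInstance n a k fl cost, ∃ g, Outputs x.N x.E (A.run x.N x.input) g ∧
        IsGoodRounding x.E x.flow g x.edgeCost := by
  by_cases h : 2 ≤ n ∧ 1 ≤ k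
  · obtain ⟨h₁, h₂, h₃⟩ := message_bounds h.1 a
    rw [roundingRounds, if_pos h]
    exact exists_rounding_algorithm n a k _ fl cost h.1 h₁ h₂ h₃
  · rw [roundingRounds, if_neg h]
    exact ⟨floorAlgorithm n _ fl, rfl, floorAlgorithm_spec h fl cost hcost⟩

/-- Rounding of flows with a cost function that depends on the labels of the edges and on which
endpoints are the source. -/
theorem exists_algorithm_family (a : ℕ) {L : Type} (fl : L → ℝ) (cost : Bool → Bool → L → ℤ)
    (hcost : ∀ β l, 0 ≤ cost β β l) :
    ∃ A : (n : ℕ) → ℝ → CliqueAlgorithm n ((a + 4) * Nat.clog 2 n) (LocalInput L) LocalOutput,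
      (∀ (n : ℕ) (Δ : ℝ), 1 ≤ n → (∃ k : ℕ, 1 / Δ = 2 ^ k) →
        ((A n Δ).rounds : ℝ) ≤ 11 * Real.logb 2 n * logStar n * Real.logb 2 (1 / Δ)) ∧
      ∀ (n : ℕ) (Δ : ℝ) (N : CliqueNetwork n) (E : Finset (Fin n × Fin n)) (s t : Fin n)
        (label : Fin n × Fin n → L), (∀ v, N.id v < n ^ a) →
        (∀ e ∈ E, |cost (decide (e.1 = s)) (decide (e.2 = s)) (label e)| ≤ (n ^ a : ℕ)) →
        HasGranularity E (fun e => fl (label e)) Δ →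
        ∃ g, Outputs N E ((A n Δ).run N (localInput N E s t label)) g ∧
          IsGoodRounding E (fun e => fl (label e)) g
            fun e => cost (decide (e.1 = s)) (decide (e.2 = s)) (label e) := by
  classical
  choose A hA hA' using fun n k => exists_algorithm n a k fl cost hcost
  let k : ℝ → ℕ := fun Δ => if h : ∃ k : ℕ, 1 / Δ = 2 ^ k then h.choose else 0
  have hk : ∀ Δ : ℝ, (∃ k : ℕ, 1 / Δ = 2 ^ k) → 1 / Δ = 2 ^ k Δ := fun Δ h => by
    simp only [k, dif_pos h]
    exact h.choose_spec
  refine ⟨fun n Δ => A n (k Δ), fun n Δ hn h => ?_, fun n Δ N E s t label hid hc hΔ => ?_⟩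
  · have : Real.logb 2 (1 / Δ) = k Δ := by
      rw [hk Δ h, Real.logb_pow, Real.logb_self_eq_one one_lt_two, mul_one]
    rw [hA, this]
    exact roundingRounds_le hn _
  · refine hA' n (k Δ) ⟨N, E, s, t, label, hid, hc, fun e he => ?_⟩
    obtain ⟨z, hz⟩ := hΔ.2 e he
    refine ⟨z, ?_⟩
    have hne : Δ ≠ 0 := by
      rintro rfl
      have := hk 0 hΔ.1
      simp only [div_zero] at this
      exact (pow_pos two_pos _).ne this
    rw [← hk Δ hΔ.1]
    change fl (label e) = z * Δ at hz
    rw [hz]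
    field_simp

theorem IsGoodRounding.isFlow {n : ℕ} {E : Finset (Fin n × Fin n)} {cap : Fin n × Fin n → ℕ}
    {s t : Fin n} {f g : Fin n × Fin n → ℝ} {c : Fin n × Fin n → ℤ} (h : IsGoodRounding E f g c)
    (hf : IsFlow E cap s t f) : IsFlow E cap s t g where
  nonneg e he := by
    have h0 := hf.nonneg e he
    rcases h.isRounding e he with h | h <;> rw [h]
    · exact_mod_cast Int.floor_nonneg.2 h0
    · exact_mod_cast Int.ceil_nonneg h0
  conservation v hs ht := by
    have h0 := hf.conservation v hs ht
    rw [h.netOutflow_eq v ⟨0, by simpa using h0⟩, h0]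
  le_capacity e he := by
    have h0 := hf.le_capacity e he
    rcases h.isRounding e he with h | h <;> rw [h]
    · exact (Int.floor_le _).trans h0
    · have : ⌈f e⌉ ≤ (cap e : ℤ) := Int.ceil_le.2 (by exact_mod_cast h0)
      exact_mod_cast this

/-- For this cost, a rounding that is no more expensive has no smaller value, even if the value is
not an integer. -/
theorem sum_indicator_cost {n : ℕ} (E : Finset (Fin n × Fin n)) (s : Fin n)
    (f : Fin n × Fin n → ℝ) :
    ∑ e ∈ E, (((if decide (e.2 = s) then 1 else 0) - (if decide (e.1 = s) then 1 else 0) : ℤ) : ℝ) *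
      f e = -flowValue E s f := by
  rw [flowValue, netOutflow, Finset.sum_filter, Finset.sum_filter, neg_sub,
    ← Finset.sum_sub_distrib]
  refine Finset.sum_congr rfl fun e _ => ?_
  by_cases h₁ : e.1 = s <;> by_cases h₂ : e.2 = s <;> simp [h₁, h₂]

end Main

/-- `a` bounds the sizes of identifiers and costs (both are polynomial in `n`), and messages have
at most `B * ⌈log₂ n⌉` bits. The first part is rounding without costs, the second with costs. -/
theorem mainTheorem6 (a : ℕ) :
    (∃ (B : ℕ) (C : ℝ)
      (A : (n : ℕ) → ℝ → CliqueAlgorithm n (B * Nat.clog 2 n) (LocalInput ℝ) LocalOutput),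
      (∀ (n : ℕ) (Δ : ℝ), 1 ≤ n → (∃ k : ℕ, 1 / Δ = 2 ^ k) →
        ((A n Δ).rounds : ℝ) ≤ C * Real.logb 2 n * logStar n * Real.logb 2 (1 / Δ)) ∧
      ∀ (n : ℕ) (Δ : ℝ) (N : CliqueNetwork n) (E : Finset (Fin n × Fin n)) (s t : Fin n)
        (cap : Fin n × Fin n → ℕ) (f : Fin n × Fin n → ℝ),
        (∀ v, N.id v < n ^ a) → IsFlow E cap s t f → HasGranularity E f Δ →
        ∃ g : Fin n × Fin n → ℝ,
          Outputs N E ((A n Δ).run N (localInput N E s t f)) g ∧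
          IsFlow E cap s t g ∧ IsRounding E f g ∧ flowValue E s f ≤ flowValue E s g) ∧
    (∃ (B : ℕ) (C : ℝ)
      (A : (n : ℕ) → ℝ → CliqueAlgorithm n (B * Nat.clog 2 n) (LocalInput (ℝ × ℕ)) LocalOutput),
      (∀ (n : ℕ) (Δ : ℝ), 1 ≤ n → (∃ k : ℕ, 1 / Δ = 2 ^ k) →
        ((A n Δ).rounds : ℝ) ≤ C * Real.logb 2 n * logStar n * Real.logb 2 (1 / Δ)) ∧
      ∀ (n : ℕ) (Δ : ℝ) (N : CliqueNetwork n) (E : Finset (Fin n × Fin n)) (s t : Fin n)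
        (cap : Fin n × Fin n → ℕ) (f : Fin n × Fin n → ℝ) (c : Fin n × Fin n → ℕ),
        (∀ v, N.id v < n ^ a) → (∀ e ∈ E, c e ≤ n ^ a) →
        IsFlow E cap s t f → HasGranularity E f Δ → (∃ z : ℤ, flowValue E s f = z) →
        ∃ g : Fin n × Fin n → ℝ,
          Outputs N E ((A n Δ).run N (localInput N E s t fun e => (f e, c e))) g ∧
          IsFlow E cap s t g ∧ IsRounding E f g ∧ flowValue E s f ≤ flowValue E s g ∧
          flowCost E c g ≤ flowCost E c f) := by
  constructor
  · obtain ⟨A, hA, hA'⟩ := exists_algorithm_family a (id : ℝ → ℝ)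
      (fun β γ _ => (if γ then 1 else 0) - (if β then 1 else 0)) fun β _ => by simp
    refine ⟨a + 4, 11, A, hA, fun n Δ N E s t cap f hid hf hΔ => ?_⟩
    -- The costs lie in `{-1, 0, 1}`; an identifier below `n ^ a` forces `1 ≤ n ^ a`.
    have h1 : (1 : ℤ) ≤ (n ^ a : ℕ) := by exact_mod_cast (Nat.zero_le _).trans_lt (hid s)
    obtain ⟨g, hg, hr⟩ := hA' n Δ N E s t f hid
      (fun e _ => le_trans (by by_cases h₁ : e.1 = s <;> by_cases h₂ : e.2 = s <;> simp [h₁, h₂]) h1)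
      hΔ
    have hc := hr.cost_le
    rw [sum_indicator_cost, sum_indicator_cost] at hc
    exact ⟨g, hg, hr.isFlow hf, hr.isRounding, neg_le_neg_iff.1 hc⟩
  · obtain ⟨A, hA, hA'⟩ := exists_algorithm_family a (Prod.fst : ℝ × ℕ → ℝ)
      (fun _ _ l => (l.2 : ℤ)) fun _ l => by positivity
    refine ⟨a + 4, 11, A, hA, fun n Δ N E s t cap f c hid hc hf hΔ hv => ?_⟩
    obtain ⟨g, hg, hr⟩ := hA' n Δ N E s t (fun e => (f e, c e)) hid
      (fun e he => by simpa using Nat.cast_le (α := ℤ).2 (hc e he)) hΔ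
    -- The integral net outflow at `s` is preserved, which leaves the cost function free for `c`.
    refine ⟨g, hg, hr.isFlow hf, hr.isRounding, (hr.netOutflow_eq s hv).ge, ?_⟩
    simpa [flowCost] using hr.cost_le
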